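/- Let $R$ be a (unital, associative, not necessarily commutative) semiperfect ring, i.e. $1_R$ is a finite sum of pairwise orthogonal idempotents $e$ for which $\mathrm{End}_R(eR)$ is local. Fix such a decomposition $1_R=e_1+\dots+e_m$, ordered so that $e_1R,\dots,e_nR$ represent each isomorphism class among the right modules $e_1R,\dots,e_mR$ exactly once. For $k\le n$ let $\mu_k$ be the number of indices $j\le m$ with $e_jR\cong e_kR$, and let $V_k=\mathrm{top}(e_kR)$ and $V'_k=\mathrm{top}(Re_k)$ be the corresponding simple right and left modules, where $\mathrm{top}(M)=M/\mathrm{rad}(M)$. Let $\pi$ be a permutation of $\{1,\dots,n\}$ that is a Nakayama permutation of $R$, i.e. for every $k\le n$ $$\mathrm{soc}(e_kR)\cong \mathrm{top}(e_{\pi(k)}R),\qquad \mathrm{soc}(Re_{\pi(k)})\cong \mathrm{top}(Re_k),$$ and assume that the left and right socles $S_l=\mathrm{soc}({}_RR)$ and $S_r=\mathrm{soc}(R_R)$ coincide. The generalised dimension $d$ of a right (left) module of finite composition length is the sum, over the factors of a composition series, of the weights $\mu_k$ of the factors isomorphic to $V_k$ (to $V'_k$); it is infinite for modules that are not of finite length.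 A right ideal $I$ satisfies the Generalised dimension condition if $d(I)$ and $d(R/l(I))$ are finite and equal, where $l(I)=\{r\in R : rI=0\}$; a left ideal $I'$ satisfies it if $d(I')$ and $d(R/r(I'))$ are finite and equal, where $r(I')=\{r\in R: I'r=0\}$. Then the following are equivalent: (1) $\pi$ respects the multiplicities of $R$, i.e. $\mu_k=\mu_{\pi(k)}$ for every $k\le n$; (2) all semisimple right ideals and all semisimple left ideals of $R$ satisfy the Generalised dimension condition; (3) all simple right ideals of $R$ satisfy the Generalised dimension condition. -/

import Mathlib

open scoped MulOpposite

universe u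

/-! Right `R`-modules are modules over `Rᵐᵒᵖ`. In particular right ideals of `R` are terms of
`Submodule Rᵐᵒᵖ R`, and left ideals are terms of `Submodule R R`. -/

section Modules

variable (A : Type*) [Ring A] (M : Type*) [AddCommGroup M] [Module A M]

/-- The socle of a module: the sum of its simple submodules. -/
def moduleSocle : Submodule A M :=
  sSup {N : Submodule A M | IsSimpleModule A N}

/-- The top `M / rad M` of a module, where `rad M` is the intersection of the maximal submodules. -/
abbrev ModuleTop : Type _ := M ⧸ Module.jacobson A M

/-- The length function induced by assigning the length `w k` to the simple module `V k`.
If `0 = M₀ ⊂ M₁ ⊂ ⋯ ⊂ M_l = M` is a composition series with `M_{i+1} / M_i ≅ V (k i)`, then the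
length of `M` is `∑ i, w (k i)`. This does not depend on the series when the modules `V k` are
pairwise non-isomorphic, see `lengthFunction_eq`, so the infimum below is over a single
value. The length is `⊤` if there is no such series. -/
noncomputable def lengthFunction {ι : Type*} (V : ι → Type*) [∀ k, AddCommGroup (V k)]
    [∀ k, Module A (V k)] (w : ι → ℕ) : ℕ∞ :=
  ⨅ (s : CompositionSeries (Submodule A M)) (_ : s.head = ⊥) (_ : s.last = ⊤)
    (k : Fin s.length → ι)
    (_ : ∀ i : Fin s.length,
      Nonempty ((s i.succ ⧸ (s i.castSucc).comap (s i.succ).subtype) ≃ₗ[A] V (k i))),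
    ((∑ i, w (k i) : ℕ) : ℕ∞)

variable {A M}

/-- The length function is computed by any composition series (Jordan–Hölder). -/
theorem lengthFunction_eq {ι : Type*} (V : ι → Type*) [∀ k, AddCommGroup (V k)]
    [∀ k, Module A (V k)] (w : ι → ℕ) (hV : ∀ k j, Nonempty (V k ≃ₗ[A] V j) → k = j)
    (s : CompositionSeries (Submodule A M)) (h0 : s.head = ⊥) (h1 : s.last = ⊤)
    (k : Fin s.length → ι)
    (hk : ∀ i : Fin s.length,
      Nonempty ((s i.succ ⧸ (s i.castSucc).comap (s i.succ).subtype) ≃ₗ[A] V (k i))) :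
    lengthFunction A M V w = ((∑ i, w (k i) : ℕ) : ℕ∞) := by
  apply le_antisymm
  · exact iInf_le_of_le s (iInf_le_of_le h0 (iInf_le_of_le h1 (iInf_le_of_le k
      (iInf_le_of_le hk le_rfl))))
  · refine le_iInf fun t => le_iInf fun t0 => le_iInf fun t1 => le_iInf fun j => le_iInf fun hj => ?_
    obtain ⟨f, hf⟩ := CompositionSeries.jordan_holder s t (h0.trans t0.symm) (h1.trans t1.symm)
    have key : ∀ i, k i = j (f i) := fun i => by
      obtain ⟨a⟩ := hk i
      obtain ⟨b⟩ := hj (f i)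
      exact hV _ _ ⟨(a.symm.trans (hf i).linearEquiv).trans b⟩
    have : ∑ i, w (k i) = ∑ i, w (j i) :=
      Fintype.sum_equiv f _ _ fun i => by rw [key i]
    rw [this]

end Modules

section Rings

variable {R : Type u} [Ring R]

/-- The principal right ideal `eR`. -/
abbrev rightIdeal (e : R) : Submodule Rᵐᵒᵖ R := Submodule.span Rᵐᵒᵖ {e}

/-- The principal left ideal `Re`. -/
abbrev leftIdeal (e : R) : Submodule R R := Submodule.span R {e}

/-- The left annihilator `l(X) = {r | rX = 0}`, a left ideal. -/
def leftAnn (X : Set R) : Submodule R R where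
  carrier := {r | ∀ x ∈ X, r * x = 0}
  add_mem' ha hb x hx := by rw [add_mul, ha x hx, hb x hx, add_zero]
  zero_mem' x _ := zero_mul x
  smul_mem' c a ha x hx := by rw [smul_eq_mul, mul_assoc, ha x hx, mul_zero]

/-- The right annihilator `r(X) = {r | Xr = 0}`, a right ideal. -/
def rightAnn (X : Set R) : Submodule Rᵐᵒᵖ R where
  carrier := {r | ∀ x ∈ X, x * r = 0}
  add_mem' ha hb x hx := by rw [mul_add, ha x hx, hb x hx, add_zero]
  zero_mem' x _ := mul_zero x
  smul_mem' c a ha x hx := by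
    rw [MulOpposite.smul_eq_mul_unop, ← mul_assoc, ha x hx, zero_mul]

/-- `e` is a complete set of pairwise orthogonal local idempotents, i.e. `1 = ∑ i, e i` and every
`End_R(e_i R)` is a local ring. -/
structure IsLocalDecomposition {m : ℕ} (e : Fin m → R) : Prop where
  complete : CompleteOrthogonalIdempotents e
  isLocal : ∀ i, IsLocalRing (Module.End Rᵐᵒᵖ (rightIdeal (e i)))

variable (R) in
/-- A ring is semiperfect if its unity is a finite sum of pairwise orthogonal local idempotents. -/
def IsSemiperfectRing : Prop :=
  ∃ (m : ℕ) (e : Fin m → R), IsLocalDecomposition e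

variable (R) in
/-- A complete set `e_1, …, e_m` of pairwise orthogonal local idempotents together with a basic set
of idempotents chosen among them: the `k`-th basic idempotent is `e (rep k)`, and every `e_j R` is
isomorphic to exactly one of the basic right ideals. -/
structure BasicIdempotents where
  /-- the order of the ring -/
  m : ℕ
  /-- the number of basic idempotents -/
  n : ℕ
  /-- the complete set of local idempotents -/
  e : Fin m → R
  /-- the indices of the basic idempotents -/
  rep : Fin n → Fin m
  decomposition : IsLocalDecomposition e
  existsUnique_rep : ∀ j : Fin m, ∃! k : Fin n,
    Nonempty (rightIdeal (e (rep k)) ≃ₗ[Rᵐᵒᵖ] rightIdeal (e j))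

/-- Every semiperfect ring has a basic set of idempotents. -/
theorem IsSemiperfectRing.nonempty_basicIdempotents (h : IsSemiperfectRing R) :
    Nonempty (BasicIdempotents R) := by
  classical
  obtain ⟨m, e, he⟩ := h
  let S : Setoid (Fin m) :=
    { r := fun i j => Nonempty (rightIdeal (e i) ≃ₗ[Rᵐᵒᵖ] rightIdeal (e j))
      iseqv := ⟨fun i => ⟨LinearEquiv.refl _ _⟩, fun ⟨f⟩ => ⟨f.symm⟩,
        fun ⟨f⟩ ⟨g⟩ => ⟨f.trans g⟩⟩ }
  let q := Fintype.equivFin (Quotient S)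
  refine ⟨⟨m, _, e, fun k => (q.symm k).out, he, fun j => ⟨q ⟦j⟧, ?_, ?_⟩⟩⟩
  · have : S ((q.symm (q ⟦j⟧)).out) j := by
      rw [Equiv.symm_apply_apply]; exact Quotient.mk_out j
    exact this
  · intro k hk
    have : (⟦(q.symm k).out⟧ : Quotient S) = ⟦j⟧ := Quotient.sound hk
    rw [Quotient.out_eq] at this
    rw [← this, Equiv.apply_symm_apply]

namespace BasicIdempotents

variable (B : BasicIdempotents R)

/-- The basic right ideal `e_k R`. -/
abbrev basicRight (k : Fin B.n) : Submodule Rᵐᵒᵖ R := rightIdeal (B.e (B.rep k))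

/-- The basic left ideal `R e_k`. -/
abbrev basicLeft (k : Fin B.n) : Submodule R R := leftIdeal (B.e (B.rep k))

/-- The multiplicity `μ_k`, the number of indices `j ≤ m` with `e_k R ≅ e_j R`. -/
noncomputable def mult (k : Fin B.n) : ℕ :=
  Nat.card {j : Fin B.m // Nonempty (B.basicRight k ≃ₗ[Rᵐᵒᵖ] rightIdeal (B.e j))}

/-- The simple right module `V_k = top(e_k R)`. -/
abbrev V (k : Fin B.n) : Type u := ModuleTop Rᵐᵒᵖ (B.basicRight k)

/-- The simple left module `V'_k = top(R e_k)`. -/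
abbrev V' (k : Fin B.n) : Type u := ModuleTop R (B.basicLeft k)

/-- `π` is a Nakayama permutation: `soc(e_k R) ≅ top(e_{π(k)} R)` and
`soc(R e_{π(k)}) ≅ top(R e_k)` for all `k`. -/
def IsNakayamaPermutation (π : Equiv.Perm (Fin B.n)) : Prop :=
  ∀ k, Nonempty (moduleSocle Rᵐᵒᵖ (B.basicRight k) ≃ₗ[Rᵐᵒᵖ] ModuleTop Rᵐᵒᵖ (B.basicRight (π k))) ∧
    Nonempty (moduleSocle R (B.basicLeft (π k)) ≃ₗ[R] ModuleTop R (B.basicLeft k))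

/-- `π` respects the multiplicities of the ring. -/
def RespectsMultiplicities (π : Equiv.Perm (Fin B.n)) : Prop :=
  ∀ k, B.mult k = B.mult (π k)

/-- The generalised dimension of a right module: the length function with `V_k ↦ μ_k`. -/
noncomputable def rightDim (M : Type*) [AddCommGroup M] [Module Rᵐᵒᵖ M] : ℕ∞ :=
  lengthFunction Rᵐᵒᵖ M B.V B.mult

/-- The generalised dimension of a left module: the length function with `V'_k ↦ μ_k`. -/
noncomputable def leftDim (M : Type*) [AddCommGroup M] [Module R M] : ℕ∞ :=
  lengthFunction R M B.V' B.mult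

/-- The Generalised dimension condition for a right ideal `I`: the generalised dimensions of `I`
and of the left module `R / l(I)` are finite and equal. -/
def RightDimCondition (I : Submodule Rᵐᵒᵖ R) : Prop :=
  B.rightDim I ≠ ⊤ ∧ B.leftDim (R ⧸ leftAnn (I : Set R)) ≠ ⊤ ∧
    B.rightDim I = B.leftDim (R ⧸ leftAnn (I : Set R))

/-- The Generalised dimension condition for a left ideal `I`: the generalised dimensions of `I`
and of the right module `R / r(I)` are finite and equal. -/
def LeftDimCondition (I : Submodule R R) : Prop :=
  B.leftDim I ≠ ⊤ ∧ B.rightDim (R ⧸ rightAnn (I : Set R)) ≠ ⊤ ∧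
    B.leftDim I = B.rightDim (R ⧸ rightAnn (I : Set R))

end BasicIdempotents

end Rings

/-! The proof rests on the duality `Hom(-, R)` on semisimple one-sided ideals. A homomorphism from
`V_{π(k)}` to `R` is determined by the image of a generator fixed by `e_{π(k)}`. This image lies in
`S_r e_{π(k)} = S_l e_{π(k)} = soc(Re_{π(k)})`, which is simple and isomorphic to `V'_k`. The
embedding `V_{π(k)} ≅ soc(e_k R) ⊆ R` shows that the dual is nonzero, so the dual of `V_{π(k)}` is
`V'_k` (`V_dual`); symmetrically, the dual of `V'_k` is `V_{π(k)}` (`V'_dual`).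

Every homomorphism from a semisimple right ideal `I` to `R` is a left multiplication
(`exists_smul_of_linearMap`), hence `R / l(I) ≅ Hom(I, R)`. Thus if `I` is a finite sum of modules
`V_{π(k_i)}`, then `d(I) = ∑ μ_{π(k_i)}` and `d(R / l(I)) = ∑ μ_{k_i}`. These agree when `π`
respects multiplicities. Conversely, `I = soc(e_k R)` yields `μ_{π(k)} = μ_k`. -/

/-! ### Lengths of finite products of simple modules -/

section LengthFunction

variable {A M : Type*} [Ring A] [AddCommGroup M] [Module A M] {ι : Type*} {V : ι → Type*}
  [∀ k, AddCommGroup (V k)] [∀ k, Module A (V k)]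

/-- The filtration of a finite product of modules by the initial partial products. -/
def piFiltration {t : ℕ} {k : Fin t → ι} (f : M ≃ₗ[A] ∀ i, V (k i)) (i : Fin (t + 1)) :
    Submodule A M where
  carrier := {x | ∀ j : Fin t, i ≤ j.castSucc → f x j = 0}
  add_mem' hx hy j hj := by simp [hx j hj, hy j hj]
  zero_mem' j _ := by simp
  smul_mem' a x hx j hj := by simp [hx j hj]

theorem piFiltration_mono {t : ℕ} {k : Fin t → ι} (f : M ≃ₗ[A] ∀ i, V (k i)) :
    Monotone (piFiltration f) := fun _ _ h _ hx j hj => hx j (h.trans hj)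

/-- Step `i + 1` permits nonzero coordinates up to `i`. Its `i`-th coordinate map is onto `V (k i)`,
with kernel step `i`. -/
theorem piFiltration_quotient {t : ℕ} {k : Fin t → ι} (f : M ≃ₗ[A] ∀ i, V (k i)) (i : Fin t) :
    Nonempty ((piFiltration f i.succ ⧸
      (piFiltration f i.castSucc).comap (piFiltration f i.succ).subtype) ≃ₗ[A] V (k i)) := by
  classical
  let g : piFiltration f i.succ →ₗ[A] V (k i) :=
    LinearMap.proj i ∘ₗ f.toLinearMap ∘ₗ (piFiltration f i.succ).subtype
  have hg : Function.Surjective g := fun v => by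
    refine ⟨⟨f.symm (Pi.single i v), fun j hj => ?_⟩, ?_⟩
    · have : j ≠ i := by
        rintro rfl
        exact absurd hj (not_le.2 j.castSucc_lt_succ)
      simp [this]
    · simp [g]
  refine ⟨(Submodule.quotEquivOfEq _ _ ?_).trans (g.quotKerEquivOfSurjective hg)⟩
  ext ⟨x, hx⟩
  constructor
  · intro h
    exact h i le_rfl
  · intro h j hj
    rcases hj.eq_or_lt with h' | h'
    · obtain rfl := Fin.castSucc_injective _ h'
      exact h
    · exact hx j (Fin.succ_le_castSucc_iff.2 (Fin.castSucc_lt_castSucc_iff.1 h'))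

/-- The length function of a finite direct product of the simple modules `V k`. -/
theorem lengthFunction_of_equiv_pi [∀ k, IsSimpleModule A (V k)] (w : ι → ℕ)
    (hV : ∀ k j, Nonempty (V k ≃ₗ[A] V j) → k = j) {t : ℕ} {k : Fin t → ι}
    (f : M ≃ₗ[A] ∀ i, V (k i)) :
    lengthFunction A M V w = ((∑ i, w (k i) : ℕ) : ℕ∞) := by
  refine lengthFunction_eq V w hV ⟨t, piFiltration f, fun i => ?_⟩ ?_ ?_ k
    (piFiltration_quotient f)
  · obtain ⟨e⟩ := piFiltration_quotient f i
    exact (covBy_iff_quot_is_simple (piFiltration_mono f i.castSucc_lt_succ.le)).2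
      (IsSimpleModule.congr e)
  · refine (Submodule.eq_bot_iff _).2 fun x hx => f.map_eq_zero_iff.1 (funext fun j => ?_)
    exact hx j (Fin.zero_le _)
  · refine Submodule.eq_top_iff'.2 fun x j hj => ?_
    exact absurd hj (not_le.2 j.castSucc_lt_last)

/-- The length function of a simple module. -/
theorem lengthFunction_of_equiv [∀ k, IsSimpleModule A (V k)] (w : ι → ℕ)
    (hV : ∀ k j, Nonempty (V k ≃ₗ[A] V j) → k = j) {k : ι} (f : M ≃ₗ[A] V k) :
    lengthFunction A M V w = w k := by
  simpa using lengthFunction_of_equiv_pi w hV (k := fun _ : Fin 1 => k)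
    (f.trans (LinearEquiv.funUnique (Fin 1) A (V k)).symm)

/-- A finitely generated semisimple module is a finite product of simple modules, taken from any
family that represents all simple modules. -/
theorem IsSemisimpleModule.exists_equiv_pi [Module.Finite A M] [IsSemisimpleModule A M]
    (hV : ∀ N : Submodule A M, IsSimpleModule A N → ∃ k, Nonempty (N ≃ₗ[A] V k)) :
    ∃ (t : ℕ) (k : Fin t → ι), Nonempty (M ≃ₗ[A] ∀ i, V (k i)) := by
  obtain ⟨t, N, e, hN⟩ := IsSemisimpleModule.exists_linearEquiv_fin_dfinsupp A M
  choose k hk using fun i => hV (N i) (hN i)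
  exact ⟨t, k, ⟨e.trans (DFinsupp.linearEquivFunOnFintype.trans
    (LinearEquiv.piCongrRight fun i => (hk i).some))⟩⟩

end LengthFunction

/-! ### Local idempotents and their projective modules -/

section LocalIdempotents

/-- An idempotent `c` whose corner ring `cAc` is local. -/
structure IsLocalIdempotent {A : Type*} [Ring A] (c : A) : Prop where
  mul_self : c * c = c
  ne_zero : c ≠ 0
  isUnit_or : ∀ a, c * a * c = a →
    (∃ b, b * a = c ∧ a * b = c) ∨ ∃ b, b * (c - a) = c ∧ (c - a) * b = c

/-- Two idempotents `c` and `d` are equivalent if `c = uv` and `d = vu` for some `u` and `v`. -/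
def IdempotentEquiv {A : Type*} [Ring A] (c d : A) : Prop := ∃ u v, u * v = c ∧ v * u = d

/-- `x ∈ P` is a generator whose annihilator is that of the idempotent `c`, so `P ≅ Ac`. -/
structure IsIdempotentGenerator {A P : Type*} [Ring A] [AddCommGroup P] [Module A P]
    (c : A) (x : P) : Prop where
  mul_self : c * c = c
  smul_self : c • x = x
  exists_smul : ∀ y : P, ∃ a : A, a • x = y
  mul_eq_zero : ∀ a : A, a • x = 0 → a * c = 0

variable {A : Type*} [Ring A] {P Q N : Type*} [AddCommGroup P] [Module A P] [AddCommGroup Q]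
  [Module A Q] [AddCommGroup N] [Module A N] {c d : A} {x : P} {y : Q}

/-- Inverses in the corner ring are two-sided, so passing to the opposite ring only swaps the two
equations. This carries the locality of `End(eR)` over to the left ideals `Re`. -/
theorem IsLocalIdempotent.op (h : IsLocalIdempotent c) : IsLocalIdempotent (MulOpposite.op c) where
  mul_self := by rw [← MulOpposite.op_mul, h.mul_self]
  ne_zero := by simpa using h.ne_zero
  isUnit_or a ha := by
    have := h.isUnit_or a.unop (by
      rw [mul_assoc]; exact congrArg MulOpposite.unop ha)
    rcases this with ⟨b, h1, h2⟩ | ⟨b, h1, h2⟩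
    · exact .inl ⟨.op b, MulOpposite.unop_injective h2, MulOpposite.unop_injective h1⟩
    · exact .inr ⟨.op b, MulOpposite.unop_injective h2, MulOpposite.unop_injective h1⟩

theorem IdempotentEquiv.op (h : IdempotentEquiv c d) :
    IdempotentEquiv (MulOpposite.op c) (MulOpposite.op d) := by
  obtain ⟨u, v, rfl, rfl⟩ := h
  exact ⟨.op v, .op u, rfl, rfl⟩

theorem IdempotentEquiv.unop {c d : Aᵐᵒᵖ} (h : IdempotentEquiv c d) :
    IdempotentEquiv c.unop d.unop := by
  obtain ⟨u, v, rfl, rfl⟩ := h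
  exact ⟨v.unop, u.unop, rfl, rfl⟩

/-- The only nonzero idempotent of a local corner ring is its unity. -/
theorem IsLocalIdempotent.eq_of_idempotent (h : IsLocalIdempotent c) {g : A} (hg : g * g = g)
    (h0 : g ≠ 0) (hgc : c * g * c = g) : g = c := by
  have hc : c * g = g := by
    rw [← hgc, ← mul_assoc, ← mul_assoc, h.mul_self]
  rcases h.isUnit_or g hgc with ⟨b, hb, -⟩ | ⟨b, hb, -⟩
  · rw [← hc, ← hb, mul_assoc, hg]
  -- If `c - g` is invertible in the corner, then `(c - g) g = 0` forces `g = 0`.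
  · refine absurd ?_ h0
    rw [← hc, ← hb, mul_assoc, sub_mul, hc, hg, sub_self, mul_zero]

namespace IsIdempotentGenerator

theorem span_eq_top (hx : IsIdempotentGenerator c x) : Submodule.span A {x} = ⊤ :=
  Submodule.eq_top_iff'.2 fun y => Submodule.mem_span_singleton.2 (hx.exists_smul y)

theorem ne_zero (hx : IsIdempotentGenerator c x) (hc : c ≠ 0) : x ≠ 0 := fun h =>
  hc (by simpa using hx.mul_eq_zero 1 (by simp [h]))

/-- If `a • x = 0` then `a c = 0`, so `a` also kills `z = c • z`. This is the identification of
`Hom_A(Ac, N)` with `cN`. -/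
theorem exists_hom (hx : IsIdempotentGenerator c x) {z : N} (hz : c • z = z) :
    ∃ f : P →ₗ[A] N, f x = z := by
  have hs : Function.Surjective (LinearMap.toSpanSingleton A P x) := hx.exists_smul
  let φ := (LinearMap.toSpanSingleton A P x).quotKerEquivOfSurjective hs
  have hk : LinearMap.ker (LinearMap.toSpanSingleton A P x) ≤
      LinearMap.ker (LinearMap.toSpanSingleton A N z) := fun a ha => by
    have : a * c = 0 := hx.mul_eq_zero a ha
    rw [LinearMap.mem_ker, LinearMap.toSpanSingleton_apply, ← hz, smul_smul, this, zero_smul]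
  refine ⟨Submodule.liftQ _ _ hk ∘ₗ φ.symm.toLinearMap, ?_⟩
  have : φ.symm x = Submodule.Quotient.mk 1 := by
    rw [LinearEquiv.symm_apply_eq]
    simp [φ]
  simp [this]

theorem hom_ext (hx : IsIdempotentGenerator c x) {f g : P →ₗ[A] N} (h : f x = g x) : f = g := by
  ext y
  obtain ⟨a, rfl⟩ := hx.exists_smul y
  rw [map_smul, map_smul, h]

theorem nonempty_equiv (hx : IsIdempotentGenerator c x) (hy : IsIdempotentGenerator d y)
    (h : IdempotentEquiv c d) : Nonempty (P ≃ₗ[A] Q) := by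
  -- The elements `u` and `v` need not lie in `cAd` and `dAc`. The products still survive inserting
  -- the idempotents, so `x ↦ cu • y` and `y ↦ dv • x` are mutually inverse.
  have key : ∀ {c d u v : A}, c * c = c → u * v = c → v * u = d → c * u * d * v = c := by
    intro c d u v hc h1 h2
    calc c * u * d * v = c * (u * v) * (u * v) := by rw [← h2]; simp only [mul_assoc]
      _ = c := by rw [h1, hc, hc]
  obtain ⟨u, v, h1, h2⟩ := h
  obtain ⟨f, hf⟩ := hx.exists_hom (z := (c * u) • y) (by rw [smul_smul, ← mul_assoc, hx.mul_self])
  obtain ⟨g, hg⟩ := hy.exists_hom (z := (d * v) • x) (by rw [smul_smul, ← mul_assoc, hy.mul_self])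
  refine ⟨LinearEquiv.ofLinearMap f g (hy.hom_ext ?_) (hx.hom_ext ?_)⟩
  · rw [LinearMap.comp_apply, hg, map_smul, hf, smul_smul, ← mul_assoc]
    rw [key hy.mul_self h2 h1, hy.smul_self, LinearMap.id_apply]
  · rw [LinearMap.comp_apply, hf, map_smul, hg, smul_smul, ← mul_assoc]
    rw [key hx.mul_self h1 h2, hx.smul_self, LinearMap.id_apply]

/-- In a module `P ≅ Ac` with `c` local, the sum of two proper submodules is proper. -/
theorem eq_top_or_eq_top (hx : IsIdempotentGenerator c x) (hc : IsLocalIdempotent c)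
    {S T : Submodule A P} (h : S ⊔ T = ⊤) : S = ⊤ ∨ T = ⊤ := by
  have key : ∀ {S : Submodule A P} {a b : A}, a • x ∈ S → b * (c * a * c) = c → S = ⊤ := by
    intro S a b ha hb
    rw [eq_top_iff, ← hx.span_eq_top, Submodule.span_singleton_le_iff_mem]
    have : x = (b * c) • a • x := by
      conv_lhs => rw [← hx.smul_self, ← hb]
      simp only [mul_smul, hx.smul_self]
    rw [this]
    exact S.smul_mem _ ha
  obtain ⟨s, hs, t, ht, hst⟩ := Submodule.mem_sup.1 (h ▸ Submodule.mem_top : x ∈ S ⊔ T)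
  obtain ⟨a, rfl⟩ := hx.exists_smul s
  obtain ⟨b, rfl⟩ := hx.exists_smul t
  -- Since `x = a • x + b • x`, the elements `cac` and `cbc` sum to the unity `c` of a local ring,
  -- so one of them is invertible.
  have hab : c - c * a * c = c * b * c := by
    have := hx.mul_eq_zero (1 - a - b) (by rw [sub_smul, sub_smul, one_smul, sub_sub, hst, sub_self])
    have h2 : c * ((1 - a - b) * c) = 0 := by rw [this, mul_zero]
    rw [sub_mul, sub_mul, one_mul, mul_sub, mul_sub, hx.mul_self] at h2
    rw [mul_assoc, mul_assoc]
    exact sub_eq_zero.1 h2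
  have hcc : c * (c * a * c) * c = c * a * c := by
    rw [← mul_assoc, ← mul_assoc, hx.mul_self, mul_assoc, hx.mul_self]
  rcases hc.isUnit_or _ hcc with ⟨g, hg, -⟩ | ⟨g, hg, -⟩
  · exact .inl (key hs hg)
  · exact .inr (key ht (hab ▸ hg))

/-- Two distinct maximal submodules would have sum `P`, so there is only one, and it is the radical.
Finite generation puts every proper submodule inside it. -/
theorem isCoatom_jacobson_and_le (hx : IsIdempotentGenerator c x) (hc : IsLocalIdempotent c) :
    IsCoatom (Module.jacobson A P) ∧ ∀ S : Submodule A P, S ≠ ⊤ → S ≤ Module.jacobson A P := by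
  have : Nontrivial P := ⟨x, 0, hx.ne_zero hc.ne_zero⟩
  have : Module.Finite A P := ⟨⟨{x}, by simpa using hx.span_eq_top⟩⟩
  have huniq : ∀ S T : Submodule A P, IsCoatom S → IsCoatom T → S = T := fun S T hS hT => by
    by_contra hne
    rcases hx.eq_top_or_eq_top hc (hS.sup_eq_top_of_ne hT hne) with h | h
    exacts [hS.1 h, hT.1 h]
  have hle : ∀ S : Submodule A P, IsCoatom S → S ≤ Module.jacobson A P := fun S hS =>
    le_sInf fun T hT => (huniq S T hS hT).le
  obtain ⟨S, hS⟩ := IsCoatomic.exists_coatom (Submodule A P)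
  refine ⟨?_, fun T hT => ?_⟩
  · have : Module.jacobson A P = S := le_antisymm (sInf_le hS) (hle S hS)
    rwa [this]
  · rcases eq_top_or_exists_le_coatom T with h | ⟨S', hS', h⟩
    exacts [absurd h hT, h.trans (hle S' hS')]

theorem isSimpleModule_top (hx : IsIdempotentGenerator c x) (hc : IsLocalIdempotent c) :
    IsSimpleModule A (ModuleTop A P) :=
  isSimpleModule_iff_isCoatom.2 (hx.isCoatom_jacobson_and_le hc).1

theorem smul_mk (hx : IsIdempotentGenerator c x) :
    c • (Submodule.Quotient.mk x : ModuleTop A P) = Submodule.Quotient.mk x :=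
  congrArg Submodule.Quotient.mk hx.smul_self

theorem mk_ne_zero (hx : IsIdempotentGenerator c x) (hc : IsLocalIdempotent c) :
    (Submodule.Quotient.mk x : ModuleTop A P) ≠ 0 := fun h => by
  refine (hx.isCoatom_jacobson_and_le hc).1.1 (top_le_iff.1 ?_)
  rw [← hx.span_eq_top, Submodule.span_singleton_le_iff_mem]
  exact (Submodule.Quotient.mk_eq_zero _).1 h

/-- A simple module `N` with `cN ≠ 0` is isomorphic to `top(Ac)`. -/
theorem nonempty_equiv_top (hx : IsIdempotentGenerator c x) (hc : IsLocalIdempotent c)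
    [IsSimpleModule A N] {z : N} (hz : c • z = z) (h0 : z ≠ 0) :
    Nonempty (N ≃ₗ[A] ModuleTop A P) := by
  obtain ⟨f, hf⟩ := hx.exists_hom hz
  have hs : Function.Surjective f :=
    LinearMap.surjective_of_ne_zero fun h => h0 (by rw [← hf, h, LinearMap.zero_apply])
  have e := f.quotKerEquivOfSurjective hs
  have hco : IsCoatom (LinearMap.ker f) := isSimpleModule_iff_isCoatom.1 (IsSimpleModule.congr e)
  have hj := hx.isCoatom_jacobson_and_le hc
  have : LinearMap.ker f = Module.jacobson A P :=
    (hco.le_iff_eq hj.1.1).1 (hj.2 _ hco.1) |>.symm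
  exact ⟨e.symm.trans (Submodule.quotEquivOfEq _ _ this)⟩

/-- Idempotents with isomorphic tops are equivalent. -/
theorem idempotentEquiv_of_top (hx : IsIdempotentGenerator c x) (hy : IsIdempotentGenerator d y)
    (hc : IsLocalIdempotent c) (hd : IsLocalIdempotent d)
    (φ : ModuleTop A Q ≃ₗ[A] ModuleTop A P) : IdempotentEquiv c d := by
  obtain ⟨p, hp⟩ := Submodule.Quotient.mk_surjective _ (φ (Submodule.Quotient.mk y))
  have hdp : Submodule.Quotient.mk (d • p) = φ (Submodule.Quotient.mk y) := by
    rw [Submodule.Quotient.mk_smul, hp, ← map_smul, ← Submodule.Quotient.mk_smul, hy.smul_self]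
  -- A lift of a nonzero element of the top lies outside the radical, hence in no proper submodule.
  have hspan : Submodule.span A {d • p} = ⊤ := by
    by_contra hne
    have := (hx.isCoatom_jacobson_and_le hc).2 _ hne (Submodule.mem_span_singleton_self _)
    rw [(Submodule.Quotient.mk_eq_zero _).2 this] at hdp
    exact hy.mk_ne_zero hd (φ.map_eq_zero_iff.1 hdp.symm)
  obtain ⟨a, ha⟩ := Submodule.mem_span_singleton.1 (hspan ▸ Submodule.mem_top : x ∈ _)
  obtain ⟨b, rfl⟩ := hx.exists_smul p
  have h1 : c = a * d * b * c := by
    have := hx.mul_eq_zero (1 - a * d * b) (by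
      rw [sub_smul, one_smul, mul_smul, mul_smul, ha, sub_self])
    rw [sub_mul, one_mul] at this
    exact sub_eq_zero.1 this
  have huv : (c * a * d) * (d * b * c) = c := by
    calc (c * a * d) * (d * b * c) = c * (a * (d * d) * b * c) := by simp only [mul_assoc]
      _ = c := by rw [hy.mul_self, ← h1, hx.mul_self]
  -- With `uv = c` in hand, `vu` is a nonzero idempotent of the local corner `dAd`, hence equal to
  -- `d`.
  refine ⟨c * a * d, d * b * c, huv, hd.eq_of_idempotent ?_ ?_ ?_⟩
  · calc d * b * c * (c * a * d) * (d * b * c * (c * a * d))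
        = d * b * c * ((c * a * d) * (d * b * c)) * (c * a * d) := by simp only [mul_assoc]
      _ = d * b * (c * c) * (c * a * d) := by rw [huv]; simp only [mul_assoc]
      _ = _ := by rw [hx.mul_self]
  · intro h
    apply hc.ne_zero
    calc c = ((c * a * d) * (d * b * c)) * ((c * a * d) * (d * b * c)) := by
          rw [huv, hx.mul_self]
      _ = (c * a * d) * ((d * b * c) * (c * a * d)) * (d * b * c) := by simp only [mul_assoc]
      _ = 0 := by rw [h, mul_zero, zero_mul]
  · calc d * (d * b * c * (c * a * d)) * d = (d * d) * b * c * (c * a * (d * d)) := by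
          simp only [mul_assoc]
      _ = _ := by rw [hd.mul_self]

end IsIdempotentGenerator

/-- Isomorphic modules have isomorphic tops. -/
theorem nonempty_top_equiv (f : P ≃ₗ[A] Q) : Nonempty (ModuleTop A P ≃ₗ[A] ModuleTop A Q) :=
  ⟨Submodule.Quotient.equiv _ _ f (Module.map_jacobson_of_bijective f.bijective)⟩

theorem IsIdempotentGenerator.idempotentEquiv (hx : IsIdempotentGenerator c x)
    (hy : IsIdempotentGenerator d y) (hc : IsLocalIdempotent c) (hd : IsLocalIdempotent d)
    (f : Q ≃ₗ[A] P) : IdempotentEquiv c d :=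
  hx.idempotentEquiv_of_top hy hc hd (nonempty_top_equiv f).some

end LocalIdempotents

/-! ### Functoriality of the socle -/

section Socle

variable {A M N : Type*} [Ring A] [AddCommGroup M] [Module A M] [AddCommGroup N] [Module A N]

instance moduleSocle.isSemisimpleModule : IsSemisimpleModule A (moduleSocle A M) := by
  rw [moduleSocle, sSup_eq_iSup]
  exact isSemisimpleModule_biSup_of_isSemisimpleModule_submodule fun S (_ : IsSimpleModule A S) =>
    inferInstance

theorem moduleSocle_eq_top [IsSemisimpleModule A M] : moduleSocle A M = ⊤ :=
  IsSemisimpleModule.sSup_simples_eq_top A M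

/-- By Schur, the image of a simple submodule is simple or zero. -/
theorem LinearMap.map_mem_moduleSocle (f : M →ₗ[A] N) {x : M} (hx : x ∈ moduleSocle A M) :
    f x ∈ moduleSocle A N := by
  suffices moduleSocle A M ≤ (moduleSocle A N).comap f from this hx
  refine sSup_le fun S (hS : IsSimpleModule A S) y hy => ?_
  let g := f ∘ₗ S.subtype
  rcases g.injective_or_eq_zero with h | h
  · have : IsSimpleModule A (LinearMap.range g) :=
      IsSimpleModule.congr (LinearEquiv.ofInjective g h).symm
    exact (le_sSup this : LinearMap.range g ≤ moduleSocle A N) ⟨⟨y, hy⟩, rfl⟩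
  · have : f y = 0 := LinearMap.congr_fun h ⟨y, hy⟩
    rw [Submodule.mem_comap, this]
    exact zero_mem _

theorem LinearMap.mem_moduleSocle_of_isSemisimpleModule [IsSemisimpleModule A M] (f : M →ₗ[A] N)
    (x : M) : f x ∈ moduleSocle A N :=
  f.map_mem_moduleSocle (moduleSocle_eq_top (A := A) (M := M) ▸ Submodule.mem_top)

theorem Submodule.le_moduleSocle (I : Submodule A M) [IsSemisimpleModule A I] :
    I ≤ moduleSocle A M := fun x hx => I.subtype.mem_moduleSocle_of_isSemisimpleModule ⟨x, hx⟩

/-- Isomorphic modules have isomorphic socles. -/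
theorem nonempty_moduleSocle_equiv (f : M ≃ₗ[A] N) :
    Nonempty (moduleSocle A M ≃ₗ[A] moduleSocle A N) := by
  refine ⟨LinearEquiv.ofSubmodules f _ _ (le_antisymm ?_ fun y hy => ?_)⟩
  · rintro _ ⟨x, hx, rfl⟩
    exact f.toLinearMap.map_mem_moduleSocle hx
  · exact ⟨f.symm y, f.symm.toLinearMap.map_mem_moduleSocle hy, f.apply_symm_apply y⟩

end Socle

/-! ### Duality into a bimodule -/

section Bimodule

variable {A A' M : Type*} [Ring A] [Ring A'] [AddCommGroup M] [Module A M] [Module A' M]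
  [SMulCommClass A A' M]

/-- Let `S` be a semisimple `A`-submodule of a bimodule `M` that is stable under `A'` and contains
the image of every `A`-linear map `S → M`. If the Peirce components `cᵢS` and `c'ᵢS` for complete
families `c` in `A` and `c'` in `A'` are simple or zero over `A'` and `A` respectively, then every
`A`-linear map from a submodule of `S` to `M` is multiplication by an element of `A'`. -/
theorem exists_smul_of_linearMap {ι : Type*} [Fintype ι] {c : ι → A} {c' : ι → A'}
    (hc : ∑ i, c i = 1) (hc' : ∑ i, c' i = 1) (hcc : ∀ i, c i * c i = c i)
    (hcc' : ∀ i, c' i * c' i = c' i) {S : Submodule A M} [IsSemisimpleModule A S]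
    (hS : ∀ (f : S →ₗ[A] M) (s : S), f s ∈ S)
    (h : ∀ i, ∀ s ∈ S, ∀ t ∈ S, c' i • s = s → c' i • t = t → s ≠ 0 → ∃ a : A, a • s = t)
    (h' : ∀ i, ∀ s ∈ S, ∀ t ∈ S, c i • s = s → c i • t = t → s ≠ 0 → ∃ a : A', a • s = t)
    {I : Submodule A M} (hI : I ≤ S) (f : I →ₗ[A] M) : ∃ a : A', ∀ s : I, f s = a • (s : M) := by
  obtain ⟨g, rfl⟩ := IsSemisimpleModule.extension_property (Submodule.inclusion hI)
    (Submodule.inclusion_injective hI) f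
  have hstab : ∀ i, ∀ s ∈ S, c' i • s ∈ S := fun i s hs => hS (c' i • S.subtype) ⟨s, hs⟩
  have key : ∀ i, ∃ a : A', ∀ s (hs : s ∈ S), c' i • s = s → g ⟨s, hs⟩ = a • s := by
    intro i
    by_cases h0 : ∀ s ∈ S, c' i • s = s → s = 0
    · refine ⟨0, fun s hs hs' => ?_⟩
      obtain rfl := h0 s hs hs'
      rw [smul_zero]
      exact map_zero g
    · push Not at h0
      obtain ⟨s, hs, his, hs0⟩ := h0
      -- The element `u = c j • s` lies in both Peirce components `c' i S` and `c j S`.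
      obtain ⟨j, hj⟩ : ∃ j, c j • s ≠ 0 := by
        by_contra! hall
        apply hs0
        rw [← one_smul A s, ← hc, Finset.sum_smul]
        exact Finset.sum_eq_zero fun j _ => hall j
      have hjs : c j • s ∈ S := S.smul_mem _ hs
      have hjj : c j • c j • s = c j • s := by rw [smul_smul, hcc]
      -- By `A`-linearity `g u` stays in `c j S`, which is simple over `A'`; hence `g u = a • u`.
      -- Since `u` generates `c' i S` over `A` and the two actions commute, the same `a` works on
      -- all of `c' i S`.
      obtain ⟨a, ha⟩ := h' j _ hjs (g ⟨_, hjs⟩) (hS g _) hjj (by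
        rw [← map_smul]; exact congrArg g (Subtype.ext hjj)) hj
      refine ⟨a, fun t ht hit => ?_⟩
      obtain ⟨b, rfl⟩ := h i _ hjs t ht (by rw [← smul_comm, his]) hit hj
      have : (⟨b • c j • s, ht⟩ : S) = b • ⟨_, hjs⟩ := rfl
      rw [this, map_smul, ← ha, smul_comm]
  choose a ha using key
  -- The multipliers of the separate components are glued along `1 = ∑ c' i`.
  refine ⟨∑ i, a i * c' i, fun s => ?_⟩
  have hs : Submodule.inclusion hI s = ∑ i, ⟨c' i • (s : M), hstab i _ (hI s.2)⟩ := by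
    apply Subtype.ext
    rw [AddSubmonoidClass.coe_finsetSum, ← Finset.sum_smul, hc', one_smul]
    rfl
  rw [LinearMap.comp_apply, hs, map_sum, Finset.sum_smul]
  refine Finset.sum_congr rfl fun i _ => ?_
  rw [ha i _ _ (by rw [smul_smul, hcc']), smul_smul]

/-- If `X` is a simple `A`-module that embeds in the bimodule `M` and is generated by `x = cx`,
then evaluation at `x` identifies `Hom_A(X, M)` with the simple `A'`-socle of `cM`. -/
theorem nonempty_linearMap_equiv_moduleSocle {X : Type*} [AddCommGroup X] [Module A X]
    [IsSimpleModule A X] {c : A} {x : X} (hx : c • x = x) (h0 : x ≠ 0) {P : Submodule A' M}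
    (hP : ∀ s ∈ moduleSocle A M, c • s = s → ∃ h : s ∈ P, (⟨s, h⟩ : P) ∈ moduleSocle A' P)
    [IsSimpleModule A' (moduleSocle A' P)] {g : X →ₗ[A] M} (hg : g ≠ 0) :
    Nonempty ((X →ₗ[A] M) ≃ₗ[A'] moduleSocle A' P) := by
  have hsoc : ∀ f : X →ₗ[A] M, ∃ h : f x ∈ P, (⟨f x, h⟩ : P) ∈ moduleSocle A' P := fun f =>
    hP _ (f.mem_moduleSocle_of_isSemisimpleModule x) (by rw [← map_smul, hx])
  let φ : (X →ₗ[A] M) →ₗ[A'] moduleSocle A' P :=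
    { toFun := fun f => ⟨⟨f x, (hsoc f).1⟩, (hsoc f).2⟩
      map_add' := fun _ _ => rfl
      map_smul' := fun _ _ => rfl }
  have hinj : Function.Injective φ := by
    rw [injective_iff_map_eq_zero]
    intro f hf
    have hfx : f x = 0 := congrArg (fun z : moduleSocle A' P => ((z : P) : M)) hf
    ext y
    obtain ⟨a, rfl⟩ := IsSimpleModule.toSpanSingleton_surjective A h0 y
    rw [LinearMap.toSpanSingleton_apply, map_smul, hfx, smul_zero, LinearMap.zero_apply]
  -- The target is simple, so a nonzero evaluation map is onto; it is nonzero because it is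
  -- injective and `g ≠ 0`.
  refine ⟨LinearEquiv.ofBijective φ ⟨hinj, LinearMap.surjective_of_ne_zero fun h => hg (hinj ?_)⟩⟩
  rw [h, LinearMap.zero_apply, LinearMap.zero_apply]

/-- Duality turns a finite product of modules into the product of their duals. -/
theorem nonempty_linearMap_equiv_pi {t : ℕ} {I : Type*} [AddCommGroup I] [Module A I]
    {X : Fin t → Type*} [∀ i, AddCommGroup (X i)] [∀ i, Module A (X i)] {Y : Fin t → Type*}
    [∀ i, AddCommGroup (Y i)] [∀ i, Module A' (Y i)] (f : I ≃ₗ[A] ∀ i, X i)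
    (h : ∀ i, Nonempty ((X i →ₗ[A] M) ≃ₗ[A'] Y i)) :
    Nonempty ((I →ₗ[A] M) ≃ₗ[A'] ∀ i, Y i) := by
  let φ : (I →ₗ[A] M) ≃ₗ[A'] ((∀ i, X i) →ₗ[A] M) :=
    { toFun := fun g => g ∘ₗ f.symm.toLinearMap
      invFun := fun g => g ∘ₗ f.toLinearMap
      left_inv := fun g => by ext; simp
      right_inv := fun g => by ext; simp
      map_add' := fun _ _ => rfl
      map_smul' := fun _ _ => rfl }
  exact ⟨φ.trans ((LinearMap.lsum A X A').symm.trans (LinearEquiv.piCongrRight fun i => (h i).some))⟩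

end Bimodule

/-! ### Principal ideals generated by idempotents -/

section Ideals

variable {R : Type u} [Ring R] {e : R}

theorem isIdempotentGenerator_leftIdeal (he : e * e = e) :
    IsIdempotentGenerator e (⟨e, Submodule.mem_span_singleton_self e⟩ : leftIdeal e) where
  mul_self := he
  smul_self := Subtype.ext he
  exists_smul y := by
    obtain ⟨a, ha⟩ := Submodule.mem_span_singleton.1 y.2
    exact ⟨a, Subtype.ext ha⟩
  mul_eq_zero a ha := congrArg Subtype.val ha

theorem isIdempotentGenerator_rightIdeal (he : e * e = e) :
    IsIdempotentGenerator (MulOpposite.op e)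
      (⟨e, Submodule.mem_span_singleton_self e⟩ : rightIdeal e) where
  mul_self := congrArg MulOpposite.op he
  smul_self := Subtype.ext he
  exists_smul y := by
    obtain ⟨a, ha⟩ := Submodule.mem_span_singleton.1 y.2
    exact ⟨a, Subtype.ext ha⟩
  mul_eq_zero a ha := MulOpposite.unop_injective (congrArg Subtype.val ha)

theorem mem_leftIdeal_of_mul_eq {s : R} (h : s * e = s) : s ∈ leftIdeal e :=
  Submodule.mem_span_singleton.2 ⟨s, h⟩

theorem mem_rightIdeal_of_mul_eq {s : R} (h : e * s = s) : s ∈ rightIdeal e :=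
  Submodule.mem_span_singleton.2 ⟨.op s, h⟩

/-- An idempotent `e` with `End(eR)` local is a local idempotent. -/
theorem isLocalIdempotent_of_isLocalRing (he : e * e = e)
    (h : IsLocalRing (Module.End Rᵐᵒᵖ (rightIdeal e))) : IsLocalIdempotent e := by
  have hgen := isIdempotentGenerator_rightIdeal he
  set ε : rightIdeal e := ⟨e, Submodule.mem_span_singleton_self e⟩ with hε
  -- Every endomorphism of `eR` is left multiplication by its value at `e`; this identifies
  -- `End(eR)` with `eRe`.
  have happ : ∀ (f : Module.End Rᵐᵒᵖ (rightIdeal e)) (y : rightIdeal e),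
      (f y : R) = (f ε : R) * y := by
    intro f y
    obtain ⟨a, rfl⟩ := hgen.exists_smul y
    have : (f ε : R) * e = f ε := by
      have h1 : f (MulOpposite.op e • ε) = f ε := by rw [hgen.smul_self]
      rw [map_smul] at h1
      exact congrArg Subtype.val h1
    rw [map_smul]
    change (f ε : R) * a.unop = f ε * (e * a.unop)
    rw [← mul_assoc, this]
  have hunit : ∀ f : Module.End Rᵐᵒᵖ (rightIdeal e), IsUnit f →
      ∃ b, b * (f ε : R) = e ∧ (f ε : R) * b = e := by
    rintro _ ⟨f, rfl⟩
    refine ⟨(f⁻¹.1 ε : R), ?_, ?_⟩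
    · rw [← happ f⁻¹.1 (f.1 ε), ← Module.End.mul_apply, f.inv_mul, Module.End.one_apply]
    · rw [← happ f.1 (f⁻¹.1 ε), ← Module.End.mul_apply, f.mul_inv, Module.End.one_apply]
  refine ⟨he, fun h0 => ?_, fun a ha => ?_⟩
  · refine one_ne_zero (α := Module.End Rᵐᵒᵖ (rightIdeal e)) (hgen.hom_ext ?_)
    exact Subtype.ext h0
  · have hea : e * a = a := by rw [← ha, ← mul_assoc, ← mul_assoc, he]
    have hae : a * e = a := by rw [← ha, mul_assoc, he]
    obtain ⟨f, hf⟩ := hgen.exists_hom (z := (⟨a, mem_rightIdeal_of_mul_eq hea⟩ : rightIdeal e))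
      (Subtype.ext hae)
    rcases IsLocalRing.isUnit_or_isUnit_of_add_one (add_sub_cancel f 1) with h1 | h1
    · have := hunit f h1
      rw [hf] at this
      exact .inl this
    · have := hunit _ h1
      rw [LinearMap.sub_apply, hf] at this
      exact .inr this

/-- Left multiplication by `e` is a right-linear map `R → eR` fixing `s`, and linear maps preserve
socles. -/
theorem mk_mem_moduleSocle_rightIdeal {s : R} (hs : s ∈ moduleSocle Rᵐᵒᵖ R) (h : e * s = s) :
    ∃ h : s ∈ rightIdeal e, (⟨s, h⟩ : rightIdeal e) ∈ moduleSocle Rᵐᵒᵖ (rightIdeal e) := by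
  refine ⟨mem_rightIdeal_of_mul_eq h, ?_⟩
  let f : R →ₗ[Rᵐᵒᵖ] rightIdeal e :=
    { toFun := fun x => ⟨e * x, Submodule.mem_span_singleton.2 ⟨.op x, rfl⟩⟩
      map_add' := fun x y => Subtype.ext (mul_add e x y)
      map_smul' := fun a x => Subtype.ext (mul_assoc e x a.unop).symm }
  convert f.map_mem_moduleSocle hs
  exact h.symm

theorem mk_mem_moduleSocle_leftIdeal {s : R} (hs : s ∈ moduleSocle R R) (h : s * e = s) :
    ∃ h : s ∈ leftIdeal e, (⟨s, h⟩ : leftIdeal e) ∈ moduleSocle R (leftIdeal e) := by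
  refine ⟨mem_leftIdeal_of_mul_eq h, ?_⟩
  let f : R →ₗ[R] leftIdeal e :=
    { toFun := fun x => ⟨x * e, Submodule.mem_span_singleton.2 ⟨x, rfl⟩⟩
      map_add' := fun x y => Subtype.ext (add_mul x y e)
      map_smul' := fun a x => Subtype.ext (mul_assoc a x e) }
  convert f.map_mem_moduleSocle hs
  exact h.symm

end Ideals

/-! ### Annihilator quotients as duals -/

section Annihilators

variable {R : Type u} [Ring R]

/-- The map sending `a` to left multiplication by `a` on `I` has kernel `l(I)`, and `h` makes it
surjective. -/
theorem nonempty_quotient_leftAnn_equiv {I : Submodule Rᵐᵒᵖ R}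
    (h : ∀ f : I →ₗ[Rᵐᵒᵖ] R, ∃ a : R, ∀ s : I, f s = a • (s : R)) :
    Nonempty ((R ⧸ leftAnn (I : Set R)) ≃ₗ[R] (I →ₗ[Rᵐᵒᵖ] R)) := by
  let φ : R →ₗ[R] (I →ₗ[Rᵐᵒᵖ] R) := LinearMap.toSpanSingleton R _ I.subtype
  have hφ : Function.Surjective φ := fun f => by
    obtain ⟨a, ha⟩ := h f
    exact ⟨a, LinearMap.ext fun s => (ha s).symm⟩
  refine ⟨(Submodule.quotEquivOfEq _ _ ?_).trans (φ.quotKerEquivOfSurjective hφ)⟩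
  ext a
  exact ⟨fun ha => LinearMap.ext fun s => ha s s.2, fun ha s hs => LinearMap.congr_fun ha ⟨s, hs⟩⟩

theorem nonempty_quotient_rightAnn_equiv {I : Submodule R R}
    (h : ∀ f : I →ₗ[R] R, ∃ a : Rᵐᵒᵖ, ∀ s : I, f s = a • (s : R)) :
    Nonempty ((R ⧸ rightAnn (I : Set R)) ≃ₗ[Rᵐᵒᵖ] (I →ₗ[R] R)) := by
  let φ : R →ₗ[Rᵐᵒᵖ] (I →ₗ[R] R) :=
    { toFun := fun a => MulOpposite.op a • I.subtype
      map_add' := fun a b => by rw [MulOpposite.op_add, add_smul]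
      map_smul' := fun b a => by
        rw [RingHom.id_apply, smul_smul]
        rfl }
  have hφ : Function.Surjective φ := fun f => by
    obtain ⟨a, ha⟩ := h f
    exact ⟨a.unop, LinearMap.ext fun s => (ha s).symm⟩
  refine ⟨(Submodule.quotEquivOfEq _ _ ?_).trans (φ.quotKerEquivOfSurjective hφ)⟩
  ext a
  exact ⟨fun ha => LinearMap.ext fun s => ha s s.2, fun ha s hs => LinearMap.congr_fun ha ⟨s, hs⟩⟩

end Annihilators

theorem exists_smul_ne_zero {A M ι : Type*} [Ring A] [AddCommGroup M] [Module A M] [Fintype ι]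
    {c : ι → A} (hc : ∑ i, c i = 1) {x : M} (hx : x ≠ 0) : ∃ i, c i • x ≠ 0 := by
  by_contra! h
  apply hx
  rw [← one_smul A x, ← hc, Finset.sum_smul]
  exact Finset.sum_eq_zero fun i _ => h i

/-! ### Classification of the simple modules -/

namespace BasicIdempotents

variable {R : Type u} [Ring R] (B : BasicIdempotents R)

theorem e_mul_self (j : Fin B.m) : B.e j * B.e j = B.e j := B.decomposition.complete.idem j

theorem sum_e : ∑ j, B.e j = 1 := B.decomposition.complete.complete

theorem sum_op_e : ∑ j, MulOpposite.op (B.e j) = 1 := by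
  simpa using congrArg MulOpposite.opAddEquiv B.sum_e

theorem isLocalIdempotent (j : Fin B.m) : IsLocalIdempotent (B.e j) :=
  isLocalIdempotent_of_isLocalRing (B.e_mul_self j) (B.decomposition.isLocal j)

/-- The basic set is chosen through right ideals only. Rephrasing isomorphism by elements makes the
choice available for left ideals too. -/
theorem exists_idempotentEquiv (j : Fin B.m) : ∃ k, IdempotentEquiv (B.e (B.rep k)) (B.e j) := by
  obtain ⟨k, ⟨f⟩, -⟩ := B.existsUnique_rep j
  exact ⟨k, ((isIdempotentGenerator_rightIdeal (B.e_mul_self _)).idempotentEquiv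
    (isIdempotentGenerator_rightIdeal (B.e_mul_self _)) (B.isLocalIdempotent _).op
    (B.isLocalIdempotent _).op f.symm).unop⟩

theorem eq_of_idempotentEquiv {k l : Fin B.n}
    (h : IdempotentEquiv (B.e (B.rep k)) (B.e (B.rep l))) : k = l :=
  (B.existsUnique_rep (B.rep l)).unique
    ((isIdempotentGenerator_rightIdeal (B.e_mul_self _)).nonempty_equiv
      (isIdempotentGenerator_rightIdeal (B.e_mul_self _)) h.op) ⟨LinearEquiv.refl _ _⟩

instance isSimpleModule_V (k : Fin B.n) : IsSimpleModule Rᵐᵒᵖ (B.V k) :=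
  (isIdempotentGenerator_rightIdeal (B.e_mul_self _)).isSimpleModule_top (B.isLocalIdempotent _).op

instance isSimpleModule_V' (k : Fin B.n) : IsSimpleModule R (B.V' k) :=
  (isIdempotentGenerator_leftIdeal (B.e_mul_self _)).isSimpleModule_top (B.isLocalIdempotent _)

theorem eq_of_V_equiv (k l : Fin B.n) (h : Nonempty (B.V k ≃ₗ[Rᵐᵒᵖ] B.V l)) : k = l :=
  B.eq_of_idempotentEquiv <| ((isIdempotentGenerator_rightIdeal (B.e_mul_self _)).idempotentEquiv_of_top
    (isIdempotentGenerator_rightIdeal (B.e_mul_self _)) (B.isLocalIdempotent _).op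
    (B.isLocalIdempotent _).op h.some.symm).unop

theorem eq_of_V'_equiv (k l : Fin B.n) (h : Nonempty (B.V' k ≃ₗ[R] B.V' l)) : k = l :=
  B.eq_of_idempotentEquiv <| (isIdempotentGenerator_leftIdeal (B.e_mul_self _)).idempotentEquiv_of_top
    (isIdempotentGenerator_leftIdeal (B.e_mul_self _)) (B.isLocalIdempotent _)
    (B.isLocalIdempotent _) h.some.symm

theorem nonempty_rightIdeal_equiv {i j : Fin B.m} (h : IdempotentEquiv (B.e i) (B.e j)) :
    Nonempty (rightIdeal (B.e i) ≃ₗ[Rᵐᵒᵖ] rightIdeal (B.e j)) :=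
  (isIdempotentGenerator_rightIdeal (B.e_mul_self _)).nonempty_equiv
    (isIdempotentGenerator_rightIdeal (B.e_mul_self _)) h.op

theorem nonempty_leftIdeal_equiv {i j : Fin B.m} (h : IdempotentEquiv (B.e i) (B.e j)) :
    Nonempty (leftIdeal (B.e i) ≃ₗ[R] leftIdeal (B.e j)) :=
  (isIdempotentGenerator_leftIdeal (B.e_mul_self _)).nonempty_equiv
    (isIdempotentGenerator_leftIdeal (B.e_mul_self _)) h

/-- Every simple right module is isomorphic to some `V k`. -/
theorem exists_equiv_V (X : Type*) [AddCommGroup X] [Module Rᵐᵒᵖ X] [IsSimpleModule Rᵐᵒᵖ X] :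
    ∃ k, Nonempty (X ≃ₗ[Rᵐᵒᵖ] B.V k) := by
  have := IsSimpleModule.nontrivial Rᵐᵒᵖ X
  obtain ⟨x, hx⟩ := exists_ne (0 : X)
  obtain ⟨j, hj⟩ := exists_smul_ne_zero B.sum_op_e hx
  obtain ⟨k, hk⟩ := B.exists_idempotentEquiv j
  have hgen := isIdempotentGenerator_rightIdeal (B.e_mul_self j)
  obtain ⟨f⟩ := hgen.nonempty_equiv_top (B.isLocalIdempotent j).op
    (by rw [smul_smul, hgen.mul_self]) hj
  exact ⟨k, ⟨f.trans (nonempty_top_equiv (B.nonempty_rightIdeal_equiv hk).some).some.symm⟩⟩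

/-- Every simple left module is isomorphic to some `V' k`. -/
theorem exists_equiv_V' (X : Type*) [AddCommGroup X] [Module R X] [IsSimpleModule R X] :
    ∃ k, Nonempty (X ≃ₗ[R] B.V' k) := by
  have := IsSimpleModule.nontrivial R X
  obtain ⟨x, hx⟩ := exists_ne (0 : X)
  obtain ⟨j, hj⟩ := exists_smul_ne_zero B.sum_e hx
  obtain ⟨k, hk⟩ := B.exists_idempotentEquiv j
  have hgen := isIdempotentGenerator_leftIdeal (B.e_mul_self j)
  obtain ⟨f⟩ := hgen.nonempty_equiv_top (B.isLocalIdempotent j)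
    (by rw [smul_smul, hgen.mul_self]) hj
  exact ⟨k, ⟨f.trans (nonempty_top_equiv (B.nonempty_leftIdeal_equiv hk).some).some.symm⟩⟩

variable {B} {π : Equiv.Perm (Fin B.n)}

/-! ### Consequences of a Nakayama permutation -/

namespace IsNakayamaPermutation

theorem isSimpleModule_moduleSocle_rightIdeal (hπ : B.IsNakayamaPermutation π) (j : Fin B.m) :
    IsSimpleModule Rᵐᵒᵖ (moduleSocle Rᵐᵒᵖ (rightIdeal (B.e j))) := by
  obtain ⟨k, hk⟩ := B.exists_idempotentEquiv j
  have : IsSimpleModule Rᵐᵒᵖ (moduleSocle Rᵐᵒᵖ (B.basicRight k)) :=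
    IsSimpleModule.congr (N := B.V (π k)) (hπ k).1.some
  exact IsSimpleModule.congr
    (N := moduleSocle Rᵐᵒᵖ (B.basicRight k))
    (nonempty_moduleSocle_equiv (B.nonempty_rightIdeal_equiv hk).some).some.symm

theorem isSimpleModule_moduleSocle_leftIdeal (hπ : B.IsNakayamaPermutation π) (j : Fin B.m) :
    IsSimpleModule R (moduleSocle R (leftIdeal (B.e j))) := by
  obtain ⟨k, hk⟩ := B.exists_idempotentEquiv j
  -- Left socles are prescribed for `Re_{π(l)}`, so the index must first be written as a value of
  -- `π`.
  obtain ⟨l, rfl⟩ := π.surjective k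
  have : IsSimpleModule R (moduleSocle R (B.basicLeft (π l))) :=
    IsSimpleModule.congr (N := B.V' l) (hπ l).2.some
  exact IsSimpleModule.congr
    (N := moduleSocle R (B.basicLeft (π l)))
    (nonempty_moduleSocle_equiv (B.nonempty_leftIdeal_equiv hk).some).some.symm

/-- Both elements lie in the simple module `soc(e_j R)`. This is the elementwise form of simplicity
that `exists_smul_of_linearMap` consumes. -/
theorem exists_op_smul_eq (hπ : B.IsNakayamaPermutation π) (j : Fin B.m) {s t : R}
    (hs : s ∈ moduleSocle Rᵐᵒᵖ R) (ht : t ∈ moduleSocle Rᵐᵒᵖ R) (hs' : B.e j * s = s)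
    (ht' : B.e j * t = t) (h0 : s ≠ 0) : ∃ a : Rᵐᵒᵖ, a • s = t := by
  have := hπ.isSimpleModule_moduleSocle_rightIdeal j
  obtain ⟨h1, h2⟩ := mk_mem_moduleSocle_rightIdeal hs hs'
  obtain ⟨h3, h4⟩ := mk_mem_moduleSocle_rightIdeal ht ht'
  obtain ⟨a, ha⟩ := IsSimpleModule.toSpanSingleton_surjective Rᵐᵒᵖ
    (m := (⟨_, h2⟩ : moduleSocle Rᵐᵒᵖ (rightIdeal (B.e j))))
    (fun h => h0 (by simpa using h)) ⟨_, h4⟩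
  exact ⟨a, congrArg Subtype.val (congrArg Subtype.val ha)⟩

theorem exists_smul_eq (hπ : B.IsNakayamaPermutation π) (j : Fin B.m) {s t : R}
    (hs : s ∈ moduleSocle R R) (ht : t ∈ moduleSocle R R) (hs' : s * B.e j = s)
    (ht' : t * B.e j = t) (h0 : s ≠ 0) : ∃ a : R, a • s = t := by
  have := hπ.isSimpleModule_moduleSocle_leftIdeal j
  obtain ⟨h1, h2⟩ := mk_mem_moduleSocle_leftIdeal hs hs'
  obtain ⟨h3, h4⟩ := mk_mem_moduleSocle_leftIdeal ht ht'
  obtain ⟨a, ha⟩ := IsSimpleModule.toSpanSingleton_surjective R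
    (m := (⟨_, h2⟩ : moduleSocle R (leftIdeal (B.e j))))
    (fun h => h0 (by simpa using h)) ⟨_, h4⟩
  exact ⟨a, congrArg Subtype.val (congrArg Subtype.val ha)⟩

/-- The components `e_j s` embed the socle in the finite product of the simple modules `soc(e_j R)`.
Consequently semisimple right ideals have finite length. -/
theorem isNoetherian_moduleSocle_right (hπ : B.IsNakayamaPermutation π) :
    IsNoetherian Rᵐᵒᵖ (moduleSocle Rᵐᵒᵖ R) := by
  have := hπ.isSimpleModule_moduleSocle_rightIdeal
  have hmem : ∀ (s : moduleSocle Rᵐᵒᵖ R) (j : Fin B.m), B.e j * (s : R) ∈ moduleSocle Rᵐᵒᵖ R :=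
    fun s j => LinearMap.map_mem_moduleSocle (B.e j • LinearMap.id : R →ₗ[Rᵐᵒᵖ] R) s.2
  have hm (s : moduleSocle Rᵐᵒᵖ R) (j : Fin B.m) := mk_mem_moduleSocle_rightIdeal (hmem s j)
    (by rw [← mul_assoc, B.e_mul_self] : B.e j * (B.e j * (s : R)) = B.e j * s)
  let f : moduleSocle Rᵐᵒᵖ R →ₗ[Rᵐᵒᵖ] ∀ j, moduleSocle Rᵐᵒᵖ (rightIdeal (B.e j)) :=
    { toFun := fun s j => ⟨⟨B.e j * s, (hm s j).1⟩, (hm s j).2⟩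
      map_add' := fun s t => funext fun j => Subtype.ext (Subtype.ext (mul_add _ _ _))
      map_smul' := fun a s => funext fun j =>
        Subtype.ext (Subtype.ext (mul_assoc _ _ a.unop).symm) }
  refine isNoetherian_of_injective f ((injective_iff_map_eq_zero f).2 fun s hs => ?_)
  by_contra h0
  obtain ⟨j, hj⟩ := exists_smul_ne_zero B.sum_e (x := (s : R)) (fun h => h0 (Subtype.ext h))
  exact hj (congrArg (fun z => ((z j : rightIdeal (B.e j)) : R)) hs)

theorem isNoetherian_moduleSocle_left (hπ : B.IsNakayamaPermutation π) :
    IsNoetherian R (moduleSocle R R) := by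
  have := hπ.isSimpleModule_moduleSocle_leftIdeal
  have hmem : ∀ (s : moduleSocle R R) (j : Fin B.m), (s : R) * B.e j ∈ moduleSocle R R :=
    fun s j => LinearMap.map_mem_moduleSocle
      (MulOpposite.op (B.e j) • LinearMap.id : R →ₗ[R] R) s.2
  have hm (s : moduleSocle R R) (j : Fin B.m) := mk_mem_moduleSocle_leftIdeal (hmem s j)
    (by rw [mul_assoc, B.e_mul_self] : (s : R) * B.e j * B.e j = s * B.e j)
  let f : moduleSocle R R →ₗ[R] ∀ j, moduleSocle R (leftIdeal (B.e j)) :=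
    { toFun := fun s j => ⟨⟨s * B.e j, (hm s j).1⟩, (hm s j).2⟩
      map_add' := fun s t => funext fun j => Subtype.ext (Subtype.ext (add_mul _ _ _))
      map_smul' := fun a s => funext fun j =>
        Subtype.ext (Subtype.ext (mul_assoc a _ _)) }
  refine isNoetherian_of_injective f ((injective_iff_map_eq_zero f).2 fun s hs => ?_)
  by_contra h0
  obtain ⟨j, hj⟩ := exists_smul_ne_zero B.sum_op_e (x := (s : R)) (fun h => h0 (Subtype.ext h))
  exact hj (congrArg (fun z => ((z j : leftIdeal (B.e j)) : R)) hs)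

/-- `R / l(I) ≅ Hom(I, R)` for a semisimple right ideal `I`. -/
theorem quotient_leftAnn_equiv (hπ : B.IsNakayamaPermutation π)
    (hsoc : (moduleSocle R R : Set R) = (moduleSocle Rᵐᵒᵖ R : Set R))
    (I : Submodule Rᵐᵒᵖ R) [IsSemisimpleModule Rᵐᵒᵖ I] :
    Nonempty ((R ⧸ leftAnn (I : Set R)) ≃ₗ[R] (I →ₗ[Rᵐᵒᵖ] R)) := by
  refine nonempty_quotient_leftAnn_equiv fun f => ?_
  refine exists_smul_of_linearMap B.sum_op_e B.sum_e
    (fun i => congrArg MulOpposite.op (B.e_mul_self i)) B.e_mul_self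
    (fun g s => g.mem_moduleSocle_of_isSemisimpleModule s)
    (fun i s hs t ht hs' ht' h0 => hπ.exists_op_smul_eq i hs ht hs' ht' h0)
    (fun i s hs t ht hs' ht' h0 => hπ.exists_smul_eq i ?_ ?_ hs' ht' h0) I.le_moduleSocle f
  -- Here `S_r ⊆ S_l` is needed: simplicity of `soc(Re_i)` is applied to elements of the right
  -- socle.
  · exact (Set.ext_iff.1 hsoc s).2 hs
  · exact (Set.ext_iff.1 hsoc t).2 ht

/-- `R / r(I) ≅ Hom(I, R)` for a semisimple left ideal `I`. -/
theorem quotient_rightAnn_equiv (hπ : B.IsNakayamaPermutation π)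
    (hsoc : (moduleSocle R R : Set R) = (moduleSocle Rᵐᵒᵖ R : Set R))
    (I : Submodule R R) [IsSemisimpleModule R I] :
    Nonempty ((R ⧸ rightAnn (I : Set R)) ≃ₗ[Rᵐᵒᵖ] (I →ₗ[R] R)) := by
  refine nonempty_quotient_rightAnn_equiv fun f => ?_
  refine exists_smul_of_linearMap B.sum_e B.sum_op_e B.e_mul_self
    (fun i => congrArg MulOpposite.op (B.e_mul_self i))
    (fun g s => g.mem_moduleSocle_of_isSemisimpleModule s)
    (fun i s hs t ht hs' ht' h0 => hπ.exists_smul_eq i hs ht hs' ht' h0)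
    (fun i s hs t ht hs' ht' h0 => hπ.exists_op_smul_eq i ?_ ?_ hs' ht' h0) I.le_moduleSocle f
  · exact (Set.ext_iff.1 hsoc s).1 hs
  · exact (Set.ext_iff.1 hsoc t).1 ht

/-- The dual of the simple right module `V (π k)` is `V' k`. -/
theorem V_dual (hπ : B.IsNakayamaPermutation π)
    (hsoc : (moduleSocle R R : Set R) = (moduleSocle Rᵐᵒᵖ R : Set R))
    (k : Fin B.n) : Nonempty ((B.V (π k) →ₗ[Rᵐᵒᵖ] R) ≃ₗ[R] B.V' k) := by
  have hgen := isIdempotentGenerator_rightIdeal (B.e_mul_self (B.rep (π k)))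
  have := hπ.isSimpleModule_moduleSocle_leftIdeal (B.rep (π k))
  -- Embedding `V_{π(k)}` in `R` as `soc(e_k R)` shows that the dual is nonzero.
  let g : B.V (π k) →ₗ[Rᵐᵒᵖ] R := (B.basicRight k).subtype ∘ₗ
    (moduleSocle Rᵐᵒᵖ (B.basicRight k)).subtype ∘ₗ (hπ k).1.some.symm.toLinearMap
  have hg : Function.Injective g := (Submodule.injective_subtype _).comp
    ((Submodule.injective_subtype _).comp (LinearEquiv.injective _))
  have h0 := hgen.mk_ne_zero (B.isLocalIdempotent _).op
  obtain ⟨f⟩ := nonempty_linearMap_equiv_moduleSocle (A' := R) (P := B.basicLeft (π k))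
    hgen.smul_mk h0
    (fun s hs hs' => mk_mem_moduleSocle_leftIdeal ((Set.ext_iff.1 hsoc s).2 hs) hs')
    (g := g) (fun h => h0 (hg (by rw [h]; rfl)))
  exact ⟨f.trans (hπ k).2.some⟩

/-- The dual of the simple left module `V' k` is `V (π k)`. -/
theorem V'_dual (hπ : B.IsNakayamaPermutation π)
    (hsoc : (moduleSocle R R : Set R) = (moduleSocle Rᵐᵒᵖ R : Set R))
    (k : Fin B.n) : Nonempty ((B.V' k →ₗ[R] R) ≃ₗ[Rᵐᵒᵖ] B.V (π k)) := by
  have hgen := isIdempotentGenerator_leftIdeal (B.e_mul_self (B.rep k))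
  have := hπ.isSimpleModule_moduleSocle_rightIdeal (B.rep k)
  let g : B.V' k →ₗ[R] R := (B.basicLeft (π k)).subtype ∘ₗ
    (moduleSocle R (B.basicLeft (π k))).subtype ∘ₗ (hπ k).2.some.symm.toLinearMap
  have hg : Function.Injective g := (Submodule.injective_subtype _).comp
    ((Submodule.injective_subtype _).comp (LinearEquiv.injective _))
  have h0 := hgen.mk_ne_zero (B.isLocalIdempotent _)
  obtain ⟨f⟩ := nonempty_linearMap_equiv_moduleSocle (A' := Rᵐᵒᵖ) (P := B.basicRight k)
    hgen.smul_mk h0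
    (fun s hs hs' => mk_mem_moduleSocle_rightIdeal ((Set.ext_iff.1 hsoc s).1 hs) hs')
    (g := g) (fun h => h0 (hg (by rw [h]; rfl)))
  exact ⟨f.trans (hπ k).1.some⟩

/-- The generalised dimensions of a semisimple right ideal `I` and of `R / l(I)`. -/
theorem exists_rightDim_eq (hπ : B.IsNakayamaPermutation π)
    (hsoc : (moduleSocle R R : Set R) = (moduleSocle Rᵐᵒᵖ R : Set R))
    (I : Submodule Rᵐᵒᵖ R) [IsSemisimpleModule Rᵐᵒᵖ I] :
    ∃ (t : ℕ) (k : Fin t → Fin B.n), B.rightDim I = ((∑ i, B.mult (π (k i)) : ℕ) : ℕ∞) ∧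
      B.leftDim (R ⧸ leftAnn (I : Set R)) = ((∑ i, B.mult (k i) : ℕ) : ℕ∞) := by
  have := hπ.isNoetherian_moduleSocle_right
  have : Module.Finite Rᵐᵒᵖ I :=
    Module.Finite.of_injective (Submodule.inclusion I.le_moduleSocle)
      (Submodule.inclusion_injective _)
  -- Indexing the simple right modules through `π` makes the dual of the `i`-th factor `V' (k i)`,
  -- without `π⁻¹`.
  obtain ⟨t, k, ⟨f⟩⟩ := IsSemisimpleModule.exists_equiv_pi (A := Rᵐᵒᵖ) (M := I)
    (V := fun l => B.V (π l)) fun N hN => by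
      obtain ⟨l, hl⟩ := B.exists_equiv_V N
      exact ⟨π.symm l, by rwa [π.apply_symm_apply]⟩
  obtain ⟨g⟩ := nonempty_linearMap_equiv_pi (A' := R) (M := R) f fun i => hπ.V_dual hsoc (k i)
  exact ⟨t, k, lengthFunction_of_equiv_pi _ B.eq_of_V_equiv (k := fun i => π (k i)) f,
    lengthFunction_of_equiv_pi _ B.eq_of_V'_equiv
      ((hπ.quotient_leftAnn_equiv hsoc I).some.trans g)⟩

/-- The generalised dimensions of a semisimple left ideal `I` and of `R / r(I)`. -/
theorem exists_leftDim_eq (hπ : B.IsNakayamaPermutation π)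
    (hsoc : (moduleSocle R R : Set R) = (moduleSocle Rᵐᵒᵖ R : Set R))
    (I : Submodule R R) [IsSemisimpleModule R I] :
    ∃ (t : ℕ) (k : Fin t → Fin B.n), B.leftDim I = ((∑ i, B.mult (k i) : ℕ) : ℕ∞) ∧
      B.rightDim (R ⧸ rightAnn (I : Set R)) = ((∑ i, B.mult (π (k i)) : ℕ) : ℕ∞) := by
  have := hπ.isNoetherian_moduleSocle_left
  have : Module.Finite R I :=
    Module.Finite.of_injective (Submodule.inclusion I.le_moduleSocle)
      (Submodule.inclusion_injective _)
  obtain ⟨t, k, ⟨f⟩⟩ := IsSemisimpleModule.exists_equiv_pi (A := R) (M := I)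
    (V := B.V') fun N hN => B.exists_equiv_V' N
  obtain ⟨g⟩ := nonempty_linearMap_equiv_pi (A' := Rᵐᵒᵖ) (M := R) f fun i => hπ.V'_dual hsoc (k i)
  exact ⟨t, k, lengthFunction_of_equiv_pi _ B.eq_of_V'_equiv f,
    lengthFunction_of_equiv_pi _ B.eq_of_V_equiv (k := fun i => π (k i))
      ((hπ.quotient_rightAnn_equiv hsoc I).some.trans g)⟩

/-- The generalised dimensions of a right ideal `I ≅ V (π k)` and of `R / l(I)`. -/
theorem rightDim_eq_of_equiv (hπ : B.IsNakayamaPermutation π)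
    (hsoc : (moduleSocle R R : Set R) = (moduleSocle Rᵐᵒᵖ R : Set R))
    {I : Submodule Rᵐᵒᵖ R} {k : Fin B.n} (f : I ≃ₗ[Rᵐᵒᵖ] B.V (π k)) :
    B.rightDim I = B.mult (π k) ∧ B.leftDim (R ⧸ leftAnn (I : Set R)) = B.mult k := by
  have : IsSimpleModule Rᵐᵒᵖ I := IsSimpleModule.congr f
  obtain ⟨g⟩ := nonempty_linearMap_equiv_pi (A' := R) (M := R) (t := 1)
    (f.trans (LinearEquiv.funUnique (Fin 1) Rᵐᵒᵖ _).symm) fun _ => hπ.V_dual hsoc k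
  exact ⟨lengthFunction_of_equiv _ B.eq_of_V_equiv f, lengthFunction_of_equiv _ B.eq_of_V'_equiv
    ((hπ.quotient_leftAnn_equiv hsoc I).some.trans (g.trans (LinearEquiv.funUnique (Fin 1) R _)))⟩

end IsNakayamaPermutation

end BasicIdempotents

/-! ### The equivalence -/

theorem mainTheorem4 {R : Type u} [Ring R] (hR : IsSemiperfectRing R)
    (B : BasicIdempotents R) (π : Equiv.Perm (Fin B.n)) (hπ : B.IsNakayamaPermutation π)
    (hsoc : (moduleSocle R R : Set R) = (moduleSocle Rᵐᵒᵖ R : Set R)) :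
    List.TFAE [
      B.RespectsMultiplicities π,
      (∀ I : Submodule Rᵐᵒᵖ R, IsSemisimpleModule Rᵐᵒᵖ I → B.RightDimCondition I) ∧
        (∀ I : Submodule R R, IsSemisimpleModule R I → B.LeftDimCondition I),
      ∀ I : Submodule Rᵐᵒᵖ R, IsSimpleModule Rᵐᵒᵖ I → B.RightDimCondition I] := by
  tfae_have 1 → 2 := by
    refine fun h => ⟨fun I hI => ?_, fun I hI => ?_⟩
    · obtain ⟨t, k, h1, h2⟩ := hπ.exists_rightDim_eq hsoc I
      rw [BasicIdempotents.RightDimCondition, h1, h2]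
      exact ⟨ENat.natCast_ne_top _, ENat.natCast_ne_top _,
        congrArg _ (Finset.sum_congr rfl fun i _ => (h (k i)).symm)⟩
    · obtain ⟨t, k, h1, h2⟩ := hπ.exists_leftDim_eq hsoc I
      rw [BasicIdempotents.LeftDimCondition, h1, h2]
      exact ⟨ENat.natCast_ne_top _, ENat.natCast_ne_top _,
        congrArg _ (Finset.sum_congr rfl fun i _ => h (k i))⟩
  tfae_have 2 → 3 := fun h I hI => h.1 I inferInstance
  tfae_have 3 → 1 := by
    intro h k
    -- The test ideal is `soc(e_k R)`, regarded as a right ideal of `R`; its two dimensions are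
    -- `μ_{π(k)}` and `μ_k`.
    let I : Submodule Rᵐᵒᵖ R :=
      (moduleSocle Rᵐᵒᵖ (B.basicRight k)).map (B.basicRight k).subtype
    have f : I ≃ₗ[Rᵐᵒᵖ] B.V (π k) := (Submodule.equivMapOfInjective _
      (Submodule.injective_subtype _) _).symm.trans (hπ k).1.some
    obtain ⟨h1, h2⟩ := hπ.rightDim_eq_of_equiv hsoc f
    obtain ⟨-, -, h3⟩ := h I (IsSimpleModule.congr f)
    rw [h1, h2] at h3
    exact (ENat.natCast_inj.1 h3).symm
  tfae_finish
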